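/- **Theorem 1.** Let $(\Omega,\mathcal F,(\mathcal F_t)_{t\ge 0},\mathsf P)$ be a filtered probability space whose filtration is right-continuous (it need not be complete). Let $M=(M_t)_{t\ge 0}$ be a real-valued, adapted, càdlàg local martingale; that is, there are stopping times $T_1\le T_2\le\cdots$ with $T_n\uparrow\infty$ almost surely, such that every stopped process $(M_{t\wedge T_n})_{t\ge 0}$ is a uniformly integrable martingale (in particular $\mathsf E(|M_0|)<\infty$). For $\lambda\ge 0$ let $$\tau_\lambda:=\inf\{t\ge 0 : |M_t|>\lambda\}\in[0,\infty]$$ denote the first exit time of $M$ from $[-\lambda,\lambda]$ (with $\inf\emptyset=\infty$), and let $\Delta M_t:=M_t-M_{t-}$ denote the jump of $M$ at time $t$, where $M_{0-}:=M_0$. Then $M$ is a uniformly integrable martingale if and only if the following three conditions all hold: (A) $\displaystyle\liminf_{\lambda\uparrow\infty}\ \lambda\,\mathsf P\Bigl(\sup_{t\ge 0}|M_t|>\lambda\Bigr)=0$; (B) $\displaystyle\lim_{\lambda\uparrow\infty}\mathsf E\bigl(\mathbf 1_{\{\tau_\lambda<\infty\}}\,|\Delta M_{\tau_\lambda}|\bigr)=0$;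 (C) $\displaystyle\mathsf E\Bigl(\liminf_{t\uparrow\infty}|M_t|\Bigr)<\infty$. The expectations in (B) and (C) are of non-negative random variables and may a priori be infinite. -/

import Mathlib

open MeasureTheory ProbabilityTheory Filter Topology Set
open scoped NNReal ENNReal

/-- A real-valued process all of whose paths are right-continuous with (real) left limits. -/
def IsCadlag {Ω : Type*} (M : ℝ≥0 → Ω → ℝ) : Prop :=
  ∀ ω : Ω, ∀ t : ℝ≥0,
    ContinuousWithinAt (fun s => M s ω) (Ioi t) t ∧
      ∃ l : ℝ, Tendsto (fun s => M s ω) (𝓝[<] t) (𝓝 l)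

/-- A (càdlàg) uniformly integrable martingale with respect to the filtration `𝓕`. -/
structure IsUIMartingale {Ω : Type*} {mΩ : MeasurableSpace Ω} (M : ℝ≥0 → Ω → ℝ)
    (𝓕 : Filtration ℝ≥0 mΩ) (P : Measure Ω) : Prop where
  cadlag : IsCadlag M
  martingale : Martingale M 𝓕 P
  uniformIntegrable : UniformIntegrable M 1 P

/-- A (càdlàg, adapted) local martingale: there are stopping times `τ n` increasing almost surely
to infinity such that every stopped process `t ↦ M (min t (τ n))` is a uniformly integrable
martingale. The process is stopped without being multiplied by the indicator of `0 < τ n`,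
so that `M 0`, the value at time zero of each stopped process, is integrable. -/
structure IsLocalMartingale {Ω : Type*} {mΩ : MeasurableSpace Ω} (M : ℝ≥0 → Ω → ℝ)
    (𝓕 : Filtration ℝ≥0 mΩ) (P : Measure Ω) : Prop where
  adapted : StronglyAdapted 𝓕 M
  cadlag : IsCadlag M
  localizes : ∃ τ : ℕ → Ω → WithTop ℝ≥0, IsLocalizingSequence 𝓕 τ P ∧
    ∀ n, IsUIMartingale (stoppedProcess M (τ n)) 𝓕 P

/-- The first exit time `inf {t ≥ 0 | |M t| > r}` from `[-r, r]`, with `inf ∅ = ⊤`. -/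
noncomputable def firstExitTime {Ω : Type*} (M : ℝ≥0 → Ω → ℝ) (r : ℝ≥0) : Ω → WithTop ℝ≥0 :=
  hittingAfter M {x : ℝ | (r : ℝ) < |x|} 0

/-- The jump process `ΔM = M - M₋`, with the convention `M₋ = M` at time zero
(which is the value of `Function.leftLim` at the least time). -/
noncomputable def jump {Ω : Type*} (M : ℝ≥0 → Ω → ℝ) : ℝ≥0 → Ω → ℝ :=
  fun t ω => M t ω - Function.leftLim (fun s => M s ω) t

/-! Let `V_r` be `M` at its exit time `τ_r` from `[-r, r]`, and `0` if there is no exit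
(`exitValue`). On exit, right-continuity gives `|V_r| ≥ r`; the left limit is at most `r` in
absolute value unless the exit is at time zero. Hence `r P(τ_r < ∞) ≤ E|V_r|`, the jump term in (B)
is at most `2 E|V_r|`, and `E|V_r|` is at most the sum of the terms in (A) and (B) and `E(|M_0|; τ_r
< ∞)`. So (A) and (B) amount to control of `E|V_r|`.

If `M` is a uniformly integrable martingale, Doob's inequality on the event of exit yields `E|V_r| →
0`, and (C) holds because the almost sure limit is integrable.

Conversely, (A) and (B) give levels `r_k` with `E|V_{r_k}| → 0`. Each stopped process is dominated
by `r_k + |V_{r_k}|`, hence is a uniformly integrable martingale closed by some `Z_k`. As `P(τ_{r_k}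
< ∞) → 0`, `M` has a limit `Z`, integrable by (C). Since `Z_k - Z` vanishes off the event of exit
and equals `V_{r_k} - Z` on it, `Z_k → Z` in L¹, so `Z` closes `M`. -/

/-! ### Discretization of stopping times; stopped càdlàg processes. -/

/-- The least multiple of `1 / (n + 1)` which is strictly greater than `x`. -/
noncomputable def gridAbove (n : ℕ) (x : ℝ≥0) : ℝ≥0 := (⌊((n : ℝ≥0) + 1) * x⌋₊ + 1) / (n + 1)

lemma lt_gridAbove (n : ℕ) (x : ℝ≥0) : x < gridAbove n x := by
  rw [gridAbove, lt_div_iff₀ (by positivity), mul_comm]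
  exact Nat.lt_floor_add_one _

lemma gridAbove_le (n : ℕ) (x : ℝ≥0) : gridAbove n x ≤ x + 1 / (n + 1) := by
  rw [gridAbove, add_div]
  gcongr
  rw [div_le_iff₀ (by positivity), mul_comm x]
  exact Nat.floor_le (by positivity)

/-- Turns a condition on the discretized time into a strict bound on the original one by a grid
point that is at most `i`, whence the stopping time property. -/
lemma gridAbove_le_iff {n : ℕ} {x i : ℝ≥0} :
    gridAbove n x ≤ i ↔ x < ⌊((n : ℝ≥0) + 1) * i⌋₊ / (n + 1) := by
  rw [gridAbove, div_le_iff₀ (by positivity), lt_div_iff₀ (by positivity), mul_comm x, mul_comm i,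
    ← Nat.floor_lt (by positivity), ← Nat.succ_le_iff, Nat.le_floor_iff (by positivity)]
  simp

lemma tendsto_gridAbove (x : ℝ≥0) : Tendsto (fun n => gridAbove n x) atTop (𝓝[>] x) := by
  refine tendsto_nhdsWithin_iff.2 ⟨?_, Eventually.of_forall fun n => lt_gridAbove n x⟩
  refine tendsto_of_tendsto_of_tendsto_of_le_of_le tendsto_const_nhds ?_
    (fun n => (lt_gridAbove n x).le) (fun n => gridAbove_le n x)
  simpa using tendsto_const_nhds.add (tendsto_one_div_add_atTop_nhds_zero_nat (𝕜 := ℝ≥0))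

/-- Discretization from above of the random time `min t τ`, with values in
the multiples of `1 / (n + 1)` and `t`. -/
noncomputable def approxAbove {Ω : Type*} (τ : Ω → WithTop ℝ≥0) (t : ℝ≥0) (n : ℕ) :
    Ω → WithTop ℝ≥0 := fun ω => min ((τ ω).map (gridAbove n)) t

section approxAbove

variable {Ω : Type*} {mΩ : MeasurableSpace Ω} {𝓕 : Filtration ℝ≥0 mΩ} {τ : Ω → WithTop ℝ≥0}

lemma approxAbove_le (τ : Ω → WithTop ℝ≥0) (t : ℝ≥0) (n : ℕ) (ω : Ω) : approxAbove τ t n ω ≤ t :=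
  min_le_right _ _

lemma min_le_approxAbove (τ : Ω → WithTop ℝ≥0) (t : ℝ≥0) (n : ℕ) (ω : Ω) :
    min (τ ω) t ≤ approxAbove τ t n ω := by
  refine min_le_min_right _ ?_
  cases τ ω with
  | top => simp
  | coe a => exact WithTop.coe_le_coe.2 (lt_gridAbove n a).le

lemma countable_range_approxAbove (τ : Ω → WithTop ℝ≥0) (t : ℝ≥0) (n : ℕ) :
    (range (approxAbove τ t n)).Countable := by
  refine ((countable_range fun k : ℕ =>
    min (((k + 1) / (n + 1) : ℝ≥0) : WithTop ℝ≥0) t).union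
      (countable_singleton (t : WithTop ℝ≥0))).mono ?_
  rintro _ ⟨ω, rfl⟩
  unfold approxAbove
  cases τ ω with
  | top => exact Or.inr (min_eq_right le_top)
  | coe a => exact Or.inl ⟨⌊((n : ℝ≥0) + 1) * a⌋₊, rfl⟩

lemma isStoppingTime_approxAbove (hτ : IsStoppingTime 𝓕 τ) (t : ℝ≥0) (n : ℕ) :
    IsStoppingTime 𝓕 (approxAbove τ t n) := by
  refine IsStoppingTime.min_const (fun i => ?_) t
  have : {ω | (τ ω).map (gridAbove n) ≤ i} =
      {ω | τ ω < ((⌊((n : ℝ≥0) + 1) * i⌋₊ / (n + 1) : ℝ≥0) : WithTop ℝ≥0)} := by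
    ext ω
    simp only [mem_ofPred_eq]
    cases τ ω with
    | top => exact iff_of_false (not_le.2 (WithTop.coe_lt_top i)) not_top_lt
    | coe a =>
      simpa only [WithTop.map_coe, WithTop.coe_le_coe, WithTop.coe_lt_coe] using gridAbove_le_iff
  rw [this]
  refine 𝓕.mono ?_ _ (hτ.measurableSet_lt _)
  rw [div_le_iff₀ (by positivity), mul_comm i]
  exact Nat.floor_le (by positivity)

lemma stoppedProcess_apply_of_eq_coe {M : ℝ≥0 → Ω → ℝ} {ω : Ω} {a : ℝ≥0} (h : τ ω = a)
    (t : ℝ≥0) : stoppedProcess M τ t ω = M (min t a) ω := by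
  unfold stoppedProcess
  rw [h, ← WithTop.coe_min]
  rfl

lemma stoppedProcess_apply_of_eq_top {M : ℝ≥0 → Ω → ℝ} {ω : Ω} (h : τ ω = ⊤)
    (t : ℝ≥0) : stoppedProcess M τ t ω = M t ω :=
  stoppedProcess_eq_of_le (h ▸ le_top)

lemma stoppedValue_apply_of_eq_coe {M : ℝ≥0 → Ω → ℝ} {ω : Ω} {a : ℝ≥0} (h : τ ω = a) :
    stoppedValue M τ ω = M a ω := by
  unfold stoppedValue
  rw [h]
  rfl

lemma IsCadlag.tendsto_stoppedValue_approxAbove {M : ℝ≥0 → Ω → ℝ} (hM : IsCadlag M)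
    (τ : Ω → WithTop ℝ≥0) (t : ℝ≥0) (ω : Ω) :
    Tendsto (fun n => stoppedValue M (approxAbove τ t n) ω) atTop
      (𝓝 (stoppedProcess M τ t ω)) := by
  rcases h : τ ω with _ | a
  · have (n : ℕ) : approxAbove τ t n ω = t := by
      rw [approxAbove, h]
      exact min_eq_right le_top
    simp_rw [stoppedValue_apply_of_eq_coe (this _), stoppedProcess_apply_of_eq_top h]
    exact tendsto_const_nhds
  · have (n : ℕ) : approxAbove τ t n ω = (min (gridAbove n a) t : ℝ≥0) := by
      rw [approxAbove, h]
      rfl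
    simp_rw [stoppedValue_apply_of_eq_coe (this _), stoppedProcess_apply_of_eq_coe h]
    rcases le_or_gt t a with h | h
    · have (n : ℕ) : min (gridAbove n a) t = t := min_eq_right (h.trans (lt_gridAbove n a).le)
      simp [this, min_eq_left h]
    · rw [min_eq_right h.le]
      refine ((hM ω a).1.tendsto).comp (tendsto_nhdsWithin_iff.2 ⟨?_, ?_⟩)
      · simpa [min_eq_left h.le] using
          ((tendsto_gridAbove a).mono_right nhdsWithin_le_nhds).min (tendsto_const_nhds (x := t))
      · exact Eventually.of_forall fun n => lt_min (lt_gridAbove n a) h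

lemma stronglyMeasurable_stoppedValue_of_countable_range {M : ℝ≥0 → Ω → ℝ}
    (hM : StronglyAdapted 𝓕 M) (hτ : IsStoppingTime 𝓕 τ) (hc : (range τ).Countable) {t : ℝ≥0}
    (ht : ∀ ω, τ ω ≤ t) : StronglyMeasurable[𝓕 t] (stoppedValue M τ) := by
  refine Measurable.stronglyMeasurable fun B hB => ?_
  have : stoppedValue M τ ⁻¹' B = ⋃ v ∈ range τ, {ω | τ ω = v} ∩ (M v.untopA) ⁻¹' B := by
    ext ω
    simp only [stoppedValue, mem_preimage, mem_iUnion, mem_inter_iff, mem_ofPred_eq, exists_prop]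
    exact ⟨fun h => ⟨τ ω, mem_range_self ω, rfl, h⟩, fun ⟨v, _, hv, h⟩ => hv ▸ h⟩
  rw [this]
  refine MeasurableSet.biUnion hc ?_
  rintro _ ⟨ω, rfl⟩
  have h := ht ω
  lift τ ω to ℝ≥0 using ne_top_of_le_ne_top WithTop.coe_ne_top h with a ha
  have h := WithTop.coe_le_coe.1 h
  exact (hτ.measurableSet_eq_le h).inter (𝓕.mono h _ ((hM a).measurable hB))

/-- The approximations come from above but are capped at `t`, so they, and their limit, remain `𝓕
t`-measurable. -/
lemma StronglyAdapted.stoppedProcess_of_isCadlag {M : ℝ≥0 → Ω → ℝ} (hM : StronglyAdapted 𝓕 M)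
    (hc : IsCadlag M) (hτ : IsStoppingTime 𝓕 τ) : StronglyAdapted 𝓕 (stoppedProcess M τ) := by
  intro t
  refine stronglyMeasurable_of_tendsto atTop (fun n =>
    stronglyMeasurable_stoppedValue_of_countable_range hM (isStoppingTime_approxAbove hτ t n)
      (countable_range_approxAbove τ t n) (approxAbove_le τ t n)) ?_
  exact tendsto_pi_nhds.2 fun ω => hc.tendsto_stoppedValue_approxAbove τ t ω

lemma IsCadlag.stoppedProcess {M : ℝ≥0 → Ω → ℝ} (hM : IsCadlag M) (τ : Ω → WithTop ℝ≥0) :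
    IsCadlag (stoppedProcess M τ) := by
  intro ω t
  rcases h : τ ω with _ | a
  · simpa only [stoppedProcess_apply_of_eq_top h] using hM ω t
  · simp only [stoppedProcess_apply_of_eq_coe h]
    constructor
    · rcases lt_or_ge t a with h | h
      · refine (hM ω t).1.congr_of_eventuallyEq ?_ (by rw [min_eq_left h.le])
        filter_upwards [nhdsWithin_le_nhds (Iio_mem_nhds h)] with s hs
        rw [min_eq_left (le_of_lt hs)]
      · refine (continuousWithinAt_const (b := M a ω)).congr ?_ (by rw [min_eq_right h])
        intro s hs
        rw [min_eq_right (h.trans (le_of_lt hs))]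
    · rcases le_or_gt t a with h | h
      · obtain ⟨l, hl⟩ := (hM ω t).2
        refine ⟨l, hl.congr' ?_⟩
        filter_upwards [self_mem_nhdsWithin] with s hs
        rw [min_eq_left ((le_of_lt hs).trans h)]
      · refine ⟨M a ω, tendsto_const_nhds.congr' ?_⟩
        filter_upwards [nhdsWithin_le_nhds (Ioi_mem_nhds h)] with s hs
        rw [min_eq_right (le_of_lt hs)]

lemma IsCadlag.sub {M N : ℝ≥0 → Ω → ℝ} (hM : IsCadlag M) (hN : IsCadlag N) :
    IsCadlag (M - N) := by
  intro ω t
  obtain ⟨l, hl⟩ := (hM ω t).2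
  obtain ⟨l', hl'⟩ := (hN ω t).2
  exact ⟨(hM ω t).1.sub (hN ω t).1, l - l', hl.sub hl'⟩

end approxAbove

/-! ### Optional sampling for càdlàg martingales. -/

section OptionalSampling

variable {Ω : Type*} {mΩ : MeasurableSpace Ω} {P : Measure Ω} [IsFiniteMeasure P]
  {𝓕 : Filtration ℝ≥0 mΩ} {τ : Ω → WithTop ℝ≥0} {M : ℝ≥0 → Ω → ℝ}

lemma MeasureTheory.Martingale.stoppedValue_approxAbove_ae_eq (hM : Martingale M 𝓕 P)
    (hτ : IsStoppingTime 𝓕 τ) (t : ℝ≥0) (n : ℕ) :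
    stoppedValue M (approxAbove τ t n) =ᵐ[P]
      P[M t | (isStoppingTime_approxAbove hτ t n).measurableSpace] :=
  hM.stoppedValue_ae_eq_condExp_of_le_const_of_countable_range _ (approxAbove_le τ t n)
    (countable_range_approxAbove τ t n)

/-- The discretized values are conditional expectations of the single variable `M t`, hence
uniformly integrable; Vitali's theorem upgrades pointwise convergence to L¹. -/
lemma MeasureTheory.Martingale.tendsto_eLpNorm_stoppedValue_approxAbove (hM : Martingale M 𝓕 P)
    (hc : IsCadlag M) (hτ : IsStoppingTime 𝓕 τ) (t : ℝ≥0) :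
    Integrable (stoppedProcess M τ t) P ∧
    Tendsto (fun n => eLpNorm (stoppedValue M (approxAbove τ t n) - stoppedProcess M τ t) 1 P)
      atTop (𝓝 0) := by
  have hui : UniformIntegrable (fun n => stoppedValue M (approxAbove τ t n)) 1 P :=
    ((hM.integrable t).uniformIntegrable_condExp fun n =>
      (isStoppingTime_approxAbove hτ t n).measurableSpace_le).ae_eq fun n =>
        (hM.stoppedValue_approxAbove_ae_eq hτ t n).symm
  have ht : ∀ᵐ ω ∂P, Tendsto (fun n => stoppedValue M (approxAbove τ t n) ω) atTop
      (𝓝 (stoppedProcess M τ t ω)) :=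
    ae_of_all _ fun ω => hc.tendsto_stoppedValue_approxAbove τ t ω
  exact ⟨hui.integrable_of_ae_tendsto ht, tendsto_Lp_finite_of_tendsto_ae le_rfl ENNReal.one_ne_top
    hui.1 (hui.memLp_of_ae_tendsto ht) hui.2.1 ht⟩

lemma MeasureTheory.Martingale.setIntegral_stoppedProcess (hM : Martingale M 𝓕 P)
    (hc : IsCadlag M) (hτ : IsStoppingTime 𝓕 τ) (t : ℝ≥0) {A : Set Ω}
    (hA : MeasurableSet[(hτ.min_const t).measurableSpace] A) :
    ∫ ω in A, stoppedProcess M τ t ω ∂P = ∫ ω in A, M t ω ∂P := by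
  obtain ⟨hint, hlim⟩ := hM.tendsto_eLpNorm_stoppedValue_approxAbove hc hτ t
  have h (n : ℕ) : ∫ ω in A, stoppedValue M (approxAbove τ t n) ω ∂P = ∫ ω in A, M t ω ∂P := by
    have hA' := (hτ.min_const t).measurableSpace_mono (isStoppingTime_approxAbove hτ t n)
      (min_le_approxAbove τ t n) _ hA
    rw [← setIntegral_condExp (isStoppingTime_approxAbove hτ t n).measurableSpace_le
      (hM.integrable t) hA']
    exact setIntegral_congr_ae ((hτ.min_const t).measurableSpace_le _ hA)
      ((hM.stoppedValue_approxAbove_ae_eq hτ t n).mono fun ω h _ => h)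
  refine tendsto_nhds_unique (tendsto_setIntegral_of_L1' _ hint.1
    (F := fun n => stoppedValue M (approxAbove τ t n)) (Eventually.of_forall fun n => ?_)
    hlim A) (by simp [h])
  exact integrable_condExp.congr (hM.stoppedValue_approxAbove_ae_eq hτ t n).symm

lemma MeasureTheory.Martingale.setLIntegral_enorm_stoppedProcess_le (hM : Martingale M 𝓕 P)
    (hc : IsCadlag M) (hτ : IsStoppingTime 𝓕 τ) (t : ℝ≥0) {A : Set Ω}
    (hA : MeasurableSet[(hτ.min_const t).measurableSpace] A) :
    ∫⁻ ω in A, ‖(stoppedProcess M τ t ω)‖ₑ ∂P ≤ ∫⁻ ω in A, ‖M t ω‖ₑ ∂P := by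
  have hAm := (hτ.min_const t).measurableSpace_le _ hA
  have h (n : ℕ) : ∫⁻ ω in A, ‖stoppedValue M (approxAbove τ t n) ω‖ₑ ∂P ≤
      ∫⁻ ω in A, ‖M t ω‖ₑ ∂P := by
    have hA' := (hτ.min_const t).measurableSpace_mono (isStoppingTime_approxAbove hτ t n)
      (min_le_approxAbove τ t n) _ hA
    have h1 : A.indicator (stoppedValue M (approxAbove τ t n)) =ᵐ[P]
        P[A.indicator (M t) | (isStoppingTime_approxAbove hτ t n).measurableSpace] := by
      refine EventuallyEq.trans ?_ (condExp_indicator (hM.integrable t) hA').symm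
      filter_upwards [hM.stoppedValue_approxAbove_ae_eq hτ t n] with ω hω
      simp only [indicator, hω]
    have h2 := eLpNorm_condExp_le_eLpNorm (μ := P)
      (m := (isStoppingTime_approxAbove hτ t n).measurableSpace) (A.indicator (M t)) le_rfl
    rw [← eLpNorm_congr_ae h1] at h2
    simpa only [eLpNorm_one_eq_lintegral_enorm, enorm_indicator_eq_indicator_enorm,
      lintegral_indicator hAm] using h2
  calc ∫⁻ ω in A, ‖(stoppedProcess M τ t ω)‖ₑ ∂P
      = ∫⁻ ω in A, liminf (fun n => ‖stoppedValue M (approxAbove τ t n) ω‖ₑ) atTop ∂P := by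
        refine lintegral_congr fun ω => ?_
        exact ((hc.tendsto_stoppedValue_approxAbove τ t ω).enorm.liminf_eq).symm
    _ ≤ liminf (fun n => ∫⁻ ω in A, ‖stoppedValue M (approxAbove τ t n) ω‖ₑ ∂P) atTop := by
        refine lintegral_liminf_le fun n => ?_
        exact ((stronglyMeasurable_stoppedValue_of_countable_range hM.stronglyAdapted
          (isStoppingTime_approxAbove hτ t n) (countable_range_approxAbove τ t n)
          (approxAbove_le τ t n)).mono (𝓕.le t)).measurable.enorm
    _ ≤ ∫⁻ ω in A, ‖M t ω‖ₑ ∂P :=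
        liminf_le_of_frequently_le' (Frequently.of_forall h)

lemma martingale_of_setIntegral_eq {N : ℝ≥0 → Ω → ℝ} (hN : StronglyAdapted 𝓕 N)
    (hint : ∀ t, Integrable (N t) P)
    (h : ∀ s t, s ≤ t → ∀ A, MeasurableSet[𝓕 s] A → ∫ ω in A, N t ω ∂P = ∫ ω in A, N s ω ∂P) :
    Martingale N 𝓕 P := by
  refine ⟨hN, fun s t hst => ?_⟩
  exact (ae_eq_condExp_of_forall_setIntegral_eq (𝓕.le s) (hint t)
    (fun A _ _ => (hint s).integrableOn) (fun A hA _ => (h s t hst A hA).symm)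
    (hN s).aestronglyMeasurable).symm

/-- Optional stopping for càdlàg martingales in continuous time. -/
lemma MeasureTheory.Martingale.stoppedProcess_of_isCadlag (hM : Martingale M 𝓕 P)
    (hc : IsCadlag M) (hτ : IsStoppingTime 𝓕 τ) : Martingale (stoppedProcess M τ) 𝓕 P := by
  have hint (t : ℝ≥0) := (hM.tendsto_eLpNorm_stoppedValue_approxAbove hc hτ t).1
  refine martingale_of_setIntegral_eq (StronglyAdapted.stoppedProcess_of_isCadlag hM.stronglyAdapted
    hc hτ) hint fun s t hst A hA => ?_
  have hB : MeasurableSet[𝓕 s] {ω | τ ω ≤ s} := hτ s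
  have hAB : MeasurableSet[𝓕 s] (A \ {ω | τ ω ≤ s}) := hA.diff hB
  -- On `τ ≤ s` both stopped values are already frozen. The rest of `A` is an event of the past of
  -- `min τ t`, so sampling replaces the stopped value by `M t`.
  rw [← integral_inter_add_sdiff (𝓕.le s _ hB) (hint t).integrableOn,
    ← integral_inter_add_sdiff (𝓕.le s _ hB) (hint s).integrableOn]
  congr 1
  · refine setIntegral_congr_fun (𝓕.le s _ (hA.inter hB)) fun ω hω => ?_
    have h : τ ω ≤ s := hω.2
    rw [stoppedProcess_eq_of_ge h, stoppedProcess_eq_of_ge (h.trans (WithTop.coe_le_coe.2 hst))]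
  · have hst' : (s : WithTop ℝ≥0) ≤ t := WithTop.coe_le_coe.2 hst
    have hm : MeasurableSet[(hτ.min_const t).measurableSpace] (A \ {ω | τ ω ≤ s}) := by
      refine ⟨le_iSup 𝓕 s _ hAB, fun i => ?_⟩
      rcases le_or_gt s i with hi | hi
      · exact (𝓕.mono hi _ hAB).inter ((hτ.min_const t) i)
      · convert MeasurableSet.empty using 1
        refine eq_empty_of_forall_notMem fun ω hω => ?_
        have h1 : ¬ τ ω ≤ s := hω.1.2
        have h2 : min (τ ω) t ≤ i := hω.2
        have h3 : (i : WithTop ℝ≥0) < s := WithTop.coe_lt_coe.2 hi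
        rcases min_le_iff.1 h2 with h | h
        · exact h1 (h.trans h3.le)
        · exact absurd (hst'.trans h) (not_le.2 h3)
    rw [hM.setIntegral_stoppedProcess hc hτ t hm, ← hM.setIntegral_eq hst hAB]
    refine setIntegral_congr_fun (𝓕.le s _ hAB) fun ω hω => ?_
    exact (stoppedProcess_eq_of_le (not_le.1 hω.2).le).symm

end OptionalSampling

/-! ### Exit times, exit values and the maximal inequality. -/

section FirstExitTime

variable {Ω : Type*} {mΩ : MeasurableSpace Ω} {P : Measure Ω} {𝓕 : Filtration ℝ≥0 mΩ}
  {M : ℝ≥0 → Ω → ℝ} {r : ℝ≥0} {ω : Ω}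

lemma firstExitTime_lt_coe_iff {i : ℝ≥0} :
    firstExitTime M r ω < i ↔ ∃ j < i, (r : ℝ) < |M j ω| := by
  rw [firstExitTime, hittingAfter_lt_iff]
  simp

lemma firstExitTime_lt_top_iff : firstExitTime M r ω < ⊤ ↔ ∃ t, (r : ℝ) < |M t ω| := by
  rw [lt_top_iff_ne_top, ne_eq, firstExitTime, hittingAfter_eq_top_iff]
  simp

lemma abs_le_of_lt_firstExitTime {t : ℝ≥0} (h : t < firstExitTime M r ω) : |M t ω| ≤ r :=
  not_lt.1 (notMem_of_lt_hittingAfter (u := M) (s := {x : ℝ | (r : ℝ) < |x|}) h zero_le)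

lemma setOf_lt_iSup_enorm_eq (M : ℝ≥0 → Ω → ℝ) (r : ℝ≥0) :
    {ω | (r : ℝ≥0∞) < ⨆ t : ℝ≥0, ‖M t ω‖ₑ} = {ω | firstExitTime M r ω < ⊤} := by
  ext ω
  simp only [mem_ofPred_eq, lt_iSup_iff, firstExitTime_lt_top_iff]
  refine exists_congr fun t => ?_
  rw [enorm_eq_nnnorm, ENNReal.coe_lt_coe, ← NNReal.coe_lt_coe, coe_nnnorm, Real.norm_eq_abs]

/-- Otherwise `|M| < r` would persist on an interval to the right of `a`, delaying the exit. -/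
lemma IsCadlag.le_abs_of_firstExitTime_eq (hc : IsCadlag M) {a : ℝ≥0}
    (h : firstExitTime M r ω = a) : (r : ℝ) ≤ |M a ω| := by
  by_contra! hlt
  have h1 : ∀ᶠ s in 𝓝[>] a, |M s ω| < r := (hc ω a).1.abs.eventually_lt_const hlt
  obtain ⟨b, hab, hb⟩ := mem_nhdsGT_iff_exists_Ioo_subset.1 h1
  have h2 : firstExitTime M r ω < b := h ▸ WithTop.coe_lt_coe.2 hab
  obtain ⟨j, hjb, hj⟩ := firstExitTime_lt_coe_iff.1 h2
  have h3 : a ≤ j := by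
    have : firstExitTime M r ω ≤ j := hittingAfter_le_of_mem zero_le hj
    exact WithTop.coe_le_coe.1 (h ▸ this)
  rcases h3.eq_or_lt with rfl | h3
  · exact lt_asymm hj hlt
  · exact lt_asymm hj (hb ⟨h3, hjb⟩)

/-- The exit set is open and paths are right-continuous, so an exit before `i` is seen on a
countable dense set. Right-continuity of `𝓕` then passes from `<` to `≤`. -/
lemma isStoppingTime_firstExitTime [𝓕.IsRightContinuous] (hM : StronglyAdapted 𝓕 M)
    (hc : IsCadlag M) (r : ℝ≥0) : IsStoppingTime 𝓕 (firstExitTime M r) := by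
  refine isStoppingTime_of_measurableSet_lt_of_isRightContinuous fun i => ?_
  obtain ⟨D, hD, hdense⟩ := TopologicalSpace.exists_countable_dense ℝ≥0
  have : {ω | firstExitTime M r ω < i} = ⋃ j ∈ D ∩ Iio i, {ω | (r : ℝ) < |M j ω|} := by
    ext ω
    simp only [mem_ofPred_eq, firstExitTime_lt_coe_iff, mem_iUnion, exists_prop]
    refine ⟨fun ⟨j, hji, hj⟩ => ?_, fun ⟨j, hj, h⟩ => ⟨j, hj.2, h⟩⟩
    have h1 : ∀ᶠ s in 𝓝[>] j, (r : ℝ) < |M s ω| := (hc ω j).1.abs.eventually_const_lt hj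
    obtain ⟨b, hjb, hb⟩ := mem_nhdsGT_iff_exists_Ioo_subset.1 h1
    obtain ⟨d, hd, hdI⟩ := hdense.exists_between (lt_min hjb hji)
    exact ⟨d, ⟨hd, hdI.2.trans_le (min_le_right _ _)⟩,
      hb ⟨hdI.1, hdI.2.trans_le (min_le_left _ _)⟩⟩
  rw [this]
  refine MeasurableSet.biUnion (hD.mono inter_subset_left) fun j hj => ?_
  exact 𝓕.mono (le_of_lt hj.2) _
    ((hM j).measurable (measurableSet_lt measurable_const measurable_id.abs))

lemma IsCadlag.abs_leftLim_le (hc : IsCadlag M) {a : ℝ≥0}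
    (h : firstExitTime M r ω = a) (ha : a ≠ 0) :
    |Function.leftLim (fun s => M s ω) a| ≤ r := by
  have : (𝓝[<] a).NeBot := nhdsLT_neBot_of_exists_lt ⟨0, pos_iff_ne_zero.2 ha⟩
  refine le_of_tendsto (tendsto_leftLim_of_tendsto (hc ω a).2).abs ?_
  filter_upwards [self_mem_nhdsWithin] with s hs
  exact abs_le_of_lt_firstExitTime (h ▸ WithTop.coe_lt_coe.2 hs)

lemma jump_zero (M : ℝ≥0 → Ω → ℝ) (ω : Ω) : jump M 0 ω = 0 := by
  rw [jump, leftLim_eq_of_isBot (fun _ => zero_le), sub_self]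

lemma IsCadlag.abs_jump_le (hc : IsCadlag M) {a : ℝ≥0} (h : firstExitTime M r ω = a) :
    |jump M a ω| ≤ |M a ω| + r := by
  rcases eq_or_ne a 0 with rfl | ha
  · rw [jump_zero, abs_zero]
    positivity
  · exact (abs_sub _ _).trans (add_le_add_right (hc.abs_leftLim_le h ha) _)

/-- The term `|M 0 ω|` is there for exit at time zero, where the jump is zero by convention. -/
lemma IsCadlag.abs_le_add_abs_jump (hc : IsCadlag M) {a : ℝ≥0} (h : firstExitTime M r ω = a) :
    |M a ω| ≤ r + |M 0 ω| + |jump M a ω| := by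
  rcases eq_or_ne a 0 with rfl | ha
  · rw [jump_zero, abs_zero]
    linarith [r.coe_nonneg]
  · have h1 := hc.abs_leftLim_le h ha
    have h2 : M a ω = Function.leftLim (fun s => M s ω) a + jump M a ω := by
      rw [jump, add_sub_cancel]
    have h3 := abs_add_le (Function.leftLim (fun s => M s ω) a) (jump M a ω)
    rw [← h2] at h3
    linarith [abs_nonneg (M 0 ω)]

/-- The value of `M` at its first exit time from `[-r, r]`, set to `0` if `M` never exits. -/
noncomputable def exitValue (M : ℝ≥0 → Ω → ℝ) (r : ℝ≥0) : Ω → ℝ :=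
  {ω | firstExitTime M r ω < ⊤}.indicator (stoppedValue M (firstExitTime M r))

lemma exitValue_of_eq_coe {a : ℝ≥0} (h : firstExitTime M r ω = a) : exitValue M r ω = M a ω := by
  have h' : firstExitTime M r ω < ⊤ := h ▸ WithTop.coe_lt_top a
  rw [exitValue, indicator_of_mem (by exact h'), stoppedValue_apply_of_eq_coe h]

lemma exitValue_of_eq_top (h : firstExitTime M r ω = ⊤) : exitValue M r ω = 0 :=
  indicator_of_notMem (s := {ω | firstExitTime M r ω < ⊤}) (fun h' => (ne_of_lt h') h) _

lemma abs_stoppedProcess_firstExitTime_le (M : ℝ≥0 → Ω → ℝ) (r t : ℝ≥0) (ω : Ω) :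
    |(stoppedProcess M (firstExitTime M r) t ω)| ≤ r + |exitValue M r ω| := by
  rcases lt_or_ge (t : WithTop ℝ≥0) (firstExitTime M r ω) with h | h
  · rw [stoppedProcess_eq_of_le h.le]
    exact (abs_le_of_lt_firstExitTime h).trans (by simp)
  · obtain ⟨a, ha⟩ := WithTop.ne_top_iff_exists.1 (ne_top_of_le_ne_top WithTop.coe_ne_top h)
    have hat : a ≤ t := WithTop.coe_le_coe.1 (ha ▸ h)
    rw [stoppedProcess_apply_of_eq_coe ha.symm, min_eq_right hat, exitValue_of_eq_coe ha.symm]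
    simp

/-- Each path gives an eventually constant sequence. This supplies measurability of the exit value
and the input to Fatou's lemma. -/
lemma tendsto_indicator_stoppedProcess_exitValue (M : ℝ≥0 → Ω → ℝ) (r : ℝ≥0) (ω : Ω) :
    Tendsto (fun n : ℕ => {ω | firstExitTime M r ω ≤ (n : ℝ≥0)}.indicator
      (stoppedProcess M (firstExitTime M r) n) ω) atTop (𝓝 (exitValue M r ω)) := by
  refine tendsto_const_nhds.congr' ?_
  rcases h : firstExitTime M r ω with _ | a
  · refine Eventually.of_forall fun n => ?_
    simp only [exitValue_of_eq_top h]
    rw [indicator_of_notMem]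
    simp only [mem_ofPred_eq, h]
    exact not_le.2 (WithTop.coe_lt_top _)
  · obtain ⟨N, hN⟩ := exists_nat_ge a
    filter_upwards [eventually_ge_atTop N] with n hn
    have han : a ≤ n := hN.trans (Nat.cast_le.2 hn)
    rw [exitValue_of_eq_coe h, indicator_of_mem, stoppedProcess_apply_of_eq_coe h, min_eq_right han]
    simp only [mem_ofPred_eq, h]
    exact WithTop.coe_le_coe.2 han

variable [𝓕.IsRightContinuous]

lemma measurable_stoppedProcess_firstExitTime (hM : StronglyAdapted 𝓕 M) (hc : IsCadlag M)
    (r t : ℝ≥0) : Measurable (stoppedProcess M (firstExitTime M r) t) :=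
  ((StronglyAdapted.stoppedProcess_of_isCadlag hM hc
    (isStoppingTime_firstExitTime hM hc r) t).mono (𝓕.le t)).measurable

lemma measurableSet_firstExitTime_lt_top (hM : StronglyAdapted 𝓕 M) (hc : IsCadlag M) (r : ℝ≥0) :
    MeasurableSet {ω | firstExitTime M r ω < ⊤} := by
  have : {ω | firstExitTime M r ω < ⊤} = ⋃ n : ℕ, {ω | firstExitTime M r ω < (n : ℝ≥0)} := by
    ext ω
    simp only [mem_ofPred_eq, mem_iUnion, firstExitTime_lt_top_iff, firstExitTime_lt_coe_iff]
    refine ⟨fun ⟨t, ht⟩ => ?_, fun ⟨n, t, _, ht⟩ => ⟨t, ht⟩⟩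
    obtain ⟨n, hn⟩ := exists_nat_gt t
    exact ⟨n, t, hn, ht⟩
  rw [this]
  exact MeasurableSet.iUnion fun n =>
    𝓕.le _ _ ((isStoppingTime_firstExitTime hM hc r).measurableSet_lt n)

lemma measurable_exitValue (hM : StronglyAdapted 𝓕 M) (hc : IsCadlag M) (r : ℝ≥0) :
    Measurable (exitValue M r) :=
  measurable_of_tendsto_metrizable
    (fun n : ℕ => (measurable_stoppedProcess_firstExitTime hM hc r n).indicator
      (𝓕.le n _ (isStoppingTime_firstExitTime hM hc r n)))
    (tendsto_pi_nhds.2 (tendsto_indicator_stoppedProcess_exitValue M r))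

lemma mul_measure_firstExitTime_lt_top_le (hM : StronglyAdapted 𝓕 M) (hc : IsCadlag M) (r : ℝ≥0) :
    r * P {ω | firstExitTime M r ω < ⊤} ≤ ∫⁻ ω, ‖exitValue M r ω‖ₑ ∂P := by
  rw [← lintegral_indicator_const (measurableSet_firstExitTime_lt_top hM hc r)]
  refine lintegral_mono (indicator_le fun ω h => ?_)
  obtain ⟨a, ha⟩ := WithTop.ne_top_iff_exists.1 (show firstExitTime M r ω < ⊤ from h).ne
  rw [exitValue_of_eq_coe ha.symm, enorm_eq_nnnorm, ENNReal.coe_le_coe, ← NNReal.coe_le_coe,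
    coe_nnnorm]
  exact hc.le_abs_of_firstExitTime_eq ha.symm

lemma lintegral_jump_le (hM : StronglyAdapted 𝓕 M) (hc : IsCadlag M) (r : ℝ≥0) :
    ∫⁻ ω, {ω | firstExitTime M r ω < ⊤}.indicator
        (fun ω => ‖stoppedValue (jump M) (firstExitTime M r) ω‖ₑ) ω ∂P ≤
      2 * ∫⁻ ω, ‖exitValue M r ω‖ₑ ∂P := by
  calc _ ≤ ∫⁻ ω, ‖exitValue M r ω‖ₑ +
        {ω | firstExitTime M r ω < ⊤}.indicator (fun _ => (r : ℝ≥0∞)) ω ∂P := by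
        refine lintegral_mono (indicator_le' (fun ω h => ?_) (fun _ _ => zero_le))
        obtain ⟨a, ha⟩ := WithTop.ne_top_iff_exists.1 (show firstExitTime M r ω < ⊤ from h).ne
        rw [exitValue_of_eq_coe ha.symm, indicator_of_mem h, stoppedValue_apply_of_eq_coe ha.symm,
          enorm_eq_nnnorm, enorm_eq_nnnorm, ← ENNReal.coe_add, ENNReal.coe_le_coe,
          ← NNReal.coe_le_coe]
        exact hc.abs_jump_le ha.symm
    _ = ∫⁻ ω, ‖exitValue M r ω‖ₑ ∂P + r * P {ω | firstExitTime M r ω < ⊤} := by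
        rw [lintegral_add_left (measurable_exitValue hM hc r).enorm,
          lintegral_indicator_const (measurableSet_firstExitTime_lt_top hM hc r)]
    _ ≤ _ := by
        rw [two_mul]
        gcongr
        exact mul_measure_firstExitTime_lt_top_le hM hc r

lemma lintegral_exitValue_le (hM : StronglyAdapted 𝓕 M) (hc : IsCadlag M) (r : ℝ≥0) :
    ∫⁻ ω, ‖exitValue M r ω‖ₑ ∂P ≤
      r * P {ω | firstExitTime M r ω < ⊤} + ∫⁻ ω in {ω | firstExitTime M r ω < ⊤}, ‖M 0 ω‖ₑ ∂P +
      ∫⁻ ω, {ω | firstExitTime M r ω < ⊤}.indicator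
        (fun ω => ‖stoppedValue (jump M) (firstExitTime M r) ω‖ₑ) ω ∂P := by
  have hms := measurableSet_firstExitTime_lt_top hM hc r
  have hm0 : Measurable (fun ω => ‖M 0 ω‖ₑ) := ((hM 0).mono (𝓕.le 0)).measurable.enorm
  have hm : Measurable fun ω => {ω | firstExitTime M r ω < ⊤}.indicator (fun _ => (r : ℝ≥0∞)) ω +
      {ω | firstExitTime M r ω < ⊤}.indicator (fun ω => ‖M 0 ω‖ₑ) ω :=
    (measurable_const.indicator hms).add (hm0.indicator hms)
  rw [← lintegral_indicator_const hms, ← lintegral_indicator hms,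
    ← lintegral_add_left (measurable_const.indicator hms),
    ← lintegral_add_left hm]
  refine lintegral_mono fun ω => ?_
  rcases h : firstExitTime M r ω with _ | a
  · simp only [exitValue_of_eq_top h, enorm_zero, zero_le]
  · have h' : ω ∈ {ω | firstExitTime M r ω < ⊤} := by
      rw [mem_ofPred_eq, h]
      exact WithTop.coe_lt_top a
    simp only [indicator_of_mem h', exitValue_of_eq_coe h, stoppedValue_apply_of_eq_coe h]
    simp only [enorm_eq_nnnorm, ← ENNReal.coe_add, ENNReal.coe_le_coe]
    rw [← NNReal.coe_le_coe]
    exact hc.abs_le_add_abs_jump h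

/-- A form of Doob's maximal inequality. -/
lemma MeasureTheory.Martingale.lintegral_exitValue_le_of_forall [IsFiniteMeasure P]
    (hM : Martingale M 𝓕 P) (hc : IsCadlag M) {c : ℝ≥0∞}
    (h : ∀ n : ℕ, ∫⁻ ω in {ω | firstExitTime M r ω ≤ (n : ℝ≥0)}, ‖M n ω‖ₑ ∂P ≤ c) :
    ∫⁻ ω, ‖exitValue M r ω‖ₑ ∂P ≤ c := by
  have hτ := isStoppingTime_firstExitTime hM.stronglyAdapted hc r
  calc ∫⁻ ω, ‖exitValue M r ω‖ₑ ∂P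
      = ∫⁻ ω, liminf (fun n : ℕ => ‖{ω | firstExitTime M r ω ≤ (n : ℝ≥0)}.indicator
          (stoppedProcess M (firstExitTime M r) n) ω‖ₑ) atTop ∂P := by
        refine lintegral_congr fun ω => ?_
        exact (tendsto_indicator_stoppedProcess_exitValue M r ω).enorm.liminf_eq.symm
    _ ≤ liminf (fun n : ℕ => ∫⁻ ω, ‖{ω | firstExitTime M r ω ≤ (n : ℝ≥0)}.indicator
          (stoppedProcess M (firstExitTime M r) n) ω‖ₑ ∂P) atTop := by
        refine lintegral_liminf_le fun n => ?_
        exact ((measurable_stoppedProcess_firstExitTime hM.stronglyAdapted hc r n).indicator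
          (𝓕.le n _ (hτ n))).enorm
    _ ≤ c := by
        refine liminf_le_of_frequently_le' (Frequently.of_forall fun n => ?_)
        refine le_trans (le_of_eq ?_)
          ((hM.setLIntegral_enorm_stoppedProcess_le hc hτ n ?_).trans (h n))
        · rw [← lintegral_indicator (𝓕.le n _ (hτ n))]
          simp only [enorm_indicator_eq_indicator_enorm]
        · refine ⟨le_iSup 𝓕 (n : ℝ≥0) _ (hτ n), fun i => ?_⟩
          have : {ω | firstExitTime M r ω ≤ (n : ℝ≥0)} ∩
              {ω | min (firstExitTime M r ω) (n : ℝ≥0) ≤ i} =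
              {ω | firstExitTime M r ω ≤ (min n i : ℝ≥0)} := by
            ext ω
            rw [WithTop.coe_min, mem_inter_iff, mem_ofPred_eq, mem_ofPred_eq, mem_ofPred_eq,
              le_min_iff]
            exact ⟨fun ⟨h1, h2⟩ => ⟨h1, min_eq_left h1 ▸ h2⟩,
              fun ⟨h1, h2⟩ => ⟨h1, (min_le_left _ _).trans h2⟩⟩
          rw [this]
          exact 𝓕.mono (min_le_right _ _) _ (hτ _)

/-- The maximal inequality is used twice: with the L¹ bound `C` it gives `P(τ_r < ∞) ≤ C / r`; then
uniform integrability applies on this small event. -/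
lemma IsUIMartingale.tendsto_lintegral_exitValue [IsFiniteMeasure P] (hM : IsUIMartingale M 𝓕 P) :
    Tendsto (fun r : ℝ≥0 => ∫⁻ ω, ‖exitValue M r ω‖ₑ ∂P) atTop (𝓝 0) := by
  obtain ⟨-, hui, C, hC⟩ := hM.uniformIntegrable
  have had := hM.martingale.stronglyAdapted
  have hbound (r : ℝ≥0) : r * P {ω | firstExitTime M r ω < ⊤} ≤ C := by
    refine (mul_measure_firstExitTime_lt_top_le had hM.cadlag r).trans ?_
    refine hM.martingale.lintegral_exitValue_le_of_forall hM.cadlag fun n => ?_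
    refine (setLIntegral_le_lintegral _ _).trans ?_
    rw [← eLpNorm_one_eq_lintegral_enorm]
    exact hC n
  rw [ENNReal.tendsto_nhds_zero]
  intro ε hε
  obtain ⟨e, he, heε⟩ := ENNReal.lt_iff_exists_nnreal_btwn.1 hε
  obtain ⟨δ, hδ, h⟩ := hui (NNReal.coe_pos.2 (ENNReal.coe_pos.1 he))
  lift δ to ℝ≥0 using hδ.le
  have hδ : 0 < δ := NNReal.coe_pos.1 hδ
  filter_upwards [eventually_ge_atTop (C / δ), eventually_gt_atTop 0] with r hr hr0
  refine (hM.martingale.lintegral_exitValue_le_of_forall hM.cadlag fun n => ?_).trans heε.le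
  have hτ := isStoppingTime_firstExitTime had hM.cadlag r n
  have h1 : P {ω | firstExitTime M r ω ≤ (n : ℝ≥0)} ≤ δ := by
    calc P {ω | firstExitTime M r ω ≤ (n : ℝ≥0)} ≤ P {ω | firstExitTime M r ω < ⊤} :=
          measure_mono fun ω (hω : firstExitTime M r ω ≤ _) => hω.trans_lt (WithTop.coe_lt_top _)
      _ ≤ C / r := by
          rw [ENNReal.le_div_iff_mul_le (Or.inl (by exact_mod_cast hr0.ne')) (by simp), mul_comm]
          exact hbound r
      _ ≤ δ := by
          rw [← ENNReal.coe_div hr0.ne', ENNReal.coe_le_coe, div_le_iff₀ hr0, mul_comm]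
          exact (div_le_iff₀ hδ).1 hr
  have h2 := h (n : ℝ≥0) _ (𝓕.le _ _ hτ) (by simpa using h1)
  rw [eLpNorm_one_eq_lintegral_enorm] at h2
  simpa only [enorm_indicator_eq_indicator_enorm, lintegral_indicator (𝓕.le _ _ hτ),
    ENNReal.ofReal_coe_nnreal] using h2

end FirstExitTime

/-! ### Almost sure convergence in continuous time. -/

section Convergence

variable {Ω : Type*} {mΩ : MeasurableSpace Ω} {P : Measure Ω} [IsFiniteMeasure P]
  {𝓕 : Filtration ℝ≥0 mΩ} [𝓕.IsRightContinuous] {M : ℝ≥0 → Ω → ℝ} {Z : Ω → ℝ}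

/-- The maximal inequality is applied to `M` minus `M` stopped at `m`: zero up to `m`, and minus the
conditional expectation of `M m - Z` afterwards. -/
lemma mul_measure_exit_after_le (hM : Martingale M 𝓕 P) (hc : IsCadlag M) (hZ : Integrable Z P)
    (h : ∀ t, M t =ᵐ[P] P[Z | 𝓕 t]) (m r : ℝ≥0) :
    r * P {ω | ∃ t, m ≤ t ∧ (r : ℝ) < |M t ω - M m ω|} ≤ eLpNorm (M m - Z) 1 P := by
  set R := M - stoppedProcess M (fun _ => m) with hR
  have hRm : Martingale R 𝓕 P :=
    hM.sub (hM.stoppedProcess_of_isCadlag hc (isStoppingTime_const 𝓕 m))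
  have hRc : IsCadlag R := hc.sub (hc.stoppedProcess _)
  have hRval (t : ℝ≥0) (ω : Ω) : R t ω = M t ω - M (min t m) ω := by
    rw [hR, Pi.sub_apply, Pi.sub_apply,
      stoppedProcess_apply_of_eq_coe (τ := fun _ => (m : WithTop ℝ≥0)) rfl]
  have hle (t : ℝ≥0) : ∫⁻ ω, ‖R t ω‖ₑ ∂P ≤ eLpNorm (M m - Z) 1 P := by
    rcases le_total t m with htm | htm
    · simp [hRval, min_eq_left htm]
    · have : R t =ᵐ[P] -P[M m - Z | 𝓕 t] := by
        filter_upwards [h t, condExp_sub (hM.integrable m) hZ (𝓕 t)] with ω h1 h2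
        rw [Pi.neg_apply, h2, hRval, min_eq_right htm, Pi.sub_apply, ← h1,
          condExp_of_stronglyMeasurable (𝓕.le t)
            ((hM.stronglyAdapted m).mono (𝓕.mono htm)) (hM.integrable m), neg_sub]
      rw [← eLpNorm_one_eq_lintegral_enorm, eLpNorm_congr_ae this, eLpNorm_neg]
      exact eLpNorm_condExp_le_eLpNorm _ le_rfl
  calc r * P {ω | ∃ t, m ≤ t ∧ (r : ℝ) < |M t ω - M m ω|}
      ≤ r * P {ω | firstExitTime R r ω < ⊤} := by
        gcongr
        rintro ⟨t, hmt, ht⟩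
        refine firstExitTime_lt_top_iff.2 ⟨t, ?_⟩
        rwa [hRval, min_eq_right hmt]
    _ ≤ ∫⁻ ω, ‖exitValue R r ω‖ₑ ∂P := mul_measure_firstExitTime_lt_top_le hRm.stronglyAdapted hRc r
    _ ≤ eLpNorm (M m - Z) 1 P := hRm.lintegral_exitValue_le_of_forall hRc fun n =>
        (setLIntegral_le_lintegral _ _).trans (hle n)

/-- A càdlàg uniformly integrable martingale is closed by its almost sure limit. -/
lemma IsUIMartingale.exists_limit (hM : IsUIMartingale M 𝓕 P) :
    ∃ Z : Ω → ℝ, Integrable Z P ∧ (∀ t, M t =ᵐ[P] P[Z | 𝓕 t]) ∧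
      ∀ᵐ ω ∂P, Tendsto (fun t => M t ω) atTop (𝓝 (Z ω)) := by
  -- Discrete-time convergence along the integers provides `Z`.
  let 𝓖 : Filtration ℕ mΩ := ⟨fun n => 𝓕 n, fun i j h => 𝓕.mono (Nat.cast_le.2 h), fun n => 𝓕.le n⟩
  have hG : Martingale (fun n : ℕ => M n) 𝓖 P :=
    ⟨fun n => hM.martingale.1 n, fun i j hij => hM.martingale.2 i j (Nat.cast_le.2 hij)⟩
  have hui : UniformIntegrable (fun n : ℕ => M n) 1 P := by
    obtain ⟨h1, h2, C, hC⟩ := hM.uniformIntegrable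
    refine ⟨fun n => h1 n, fun ε hε => ?_, C, fun n => hC n⟩
    obtain ⟨δ, hδ, h⟩ := h2 hε
    exact ⟨δ, hδ, fun n => h n⟩
  set Z := Filtration.limitProcess (fun n : ℕ => M n) 𝓖 P
  obtain ⟨C, hC⟩ := hui.2.2
  have hZ : Integrable Z P :=
    (Filtration.memLp_limitProcess_of_eLpNorm_bdd hui.1 hC).integrable le_rfl
  have hMZ (t : ℝ≥0) : M t =ᵐ[P] P[Z | 𝓕 t] := by
    obtain ⟨n, hn⟩ := exists_nat_ge t
    calc M t =ᵐ[P] P[M n | 𝓕 t] := (hM.martingale.2 t n hn).symm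
      _ =ᵐ[P] P[P[Z | 𝓕 n] | 𝓕 t] := condExp_congr_ae (hG.ae_eq_condExp_limitProcess hui n)
      _ =ᵐ[P] P[Z | 𝓕 t] := condExp_condExp_of_le (𝓕.mono hn) (𝓕.le n)
  have hlim : Tendsto (fun n : ℕ => eLpNorm (M n - Z) 1 P) atTop (𝓝 0) :=
    hG.submartingale.tendsto_eLpNorm_one_limitProcess hui
  refine ⟨Z, hZ, hMZ, ?_⟩
  -- One `δ` bounds the oscillation after time `m`, the other bounds `|M m - Z|`. The bad event does
  -- not depend on `m`, so `m → ∞` makes it null.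
  have hbad (δ : ℝ≥0) (hδ : 0 < δ) : ∀ᵐ ω ∂P, ∀ᶠ t in atTop, |M t ω - Z ω| ≤ 2 * δ := by
    have hle (m : ℕ) : δ * P {ω | ¬ ∀ᶠ t in atTop, |M t ω - Z ω| ≤ 2 * δ} ≤
        2 * eLpNorm (M m - Z) 1 P := by
      have hsub : {ω | ¬ ∀ᶠ t in atTop, |M t ω - Z ω| ≤ 2 * δ} ⊆
          {ω | ∃ t, (m : ℝ≥0) ≤ t ∧ (δ : ℝ) < |M t ω - M m ω|} ∪
            {ω | (δ : ℝ≥0∞) ≤ ‖(M m - Z) ω‖ₑ} := by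
        intro ω hω
        by_contra hcon
        simp only [mem_union, mem_ofPred_eq, not_or, not_exists, not_and, not_lt, not_le] at hcon
        obtain ⟨h1, h2⟩ := hcon
        rw [enorm_eq_nnnorm, ENNReal.coe_lt_coe, ← NNReal.coe_lt_coe, coe_nnnorm,
          Real.norm_eq_abs, Pi.sub_apply] at h2
        refine hω ((eventually_ge_atTop (m : ℝ≥0)).mono fun t ht => ?_)
        have := abs_add_le (M t ω - M m ω) (M m ω - Z ω)
        rw [sub_add_sub_cancel] at this
        linarith [h1 t ht]
      calc _ ≤ δ * (P {ω | ∃ t, (m : ℝ≥0) ≤ t ∧ (δ : ℝ) < |M t ω - M m ω|} +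
            P {ω | (δ : ℝ≥0∞) ≤ ‖(M m - Z) ω‖ₑ}) := by
              gcongr
              exact (measure_mono hsub).trans (measure_union_le _ _)
        _ ≤ eLpNorm (M m - Z) 1 P + eLpNorm (M m - Z) 1 P := by
              rw [mul_add]
              refine add_le_add (mul_measure_exit_after_le hM.martingale hM.cadlag hZ hMZ m δ) ?_
              rw [eLpNorm_one_eq_lintegral_enorm]
              exact mul_meas_ge_le_lintegral₀
                ((hM.martingale.integrable m).sub hZ).aestronglyMeasurable.enorm _
        _ = _ := (two_mul _).symm
    have h0 : δ * P {ω | ¬ ∀ᶠ t in atTop, |M t ω - Z ω| ≤ 2 * δ} ≤ 0 := by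
      refine (ge_of_tendsto' (ENNReal.Tendsto.const_mul hlim (Or.inr (by simp))) hle).trans ?_
      simp
    rcases mul_eq_zero.1 (nonpos_iff_eq_zero.1 h0) with h | h
    · exact absurd h (by exact_mod_cast hδ.ne')
    · exact h
  have hall : ∀ᵐ ω ∂P, ∀ k : ℕ, ∀ᶠ t in atTop, |M t ω - Z ω| ≤ 2 * (1 / ((k : ℝ) + 1)) := by
    refine ae_all_iff.2 fun k => ?_
    simpa using hbad (1 / (k + 1)) (by positivity)
  filter_upwards [hall] with ω hω
  rw [Metric.tendsto_nhds]
  intro ε hε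
  obtain ⟨k, hk⟩ := exists_nat_one_div_lt (half_pos hε)
  filter_upwards [hω k] with t ht
  rw [Real.dist_eq]
  linarith

end Convergence

/-! ### Domination and local martingales. -/

lemma uniformIntegrable_of_abs_le {Ω ι : Type*} {mΩ : MeasurableSpace Ω} {P : Measure Ω}
    {X : ι → Ω → ℝ} {D : Ω → ℝ}
    (hX : ∀ i, AEStronglyMeasurable (X i) P) (hD : Integrable D P) (h : ∀ i ω, |X i ω| ≤ D ω) :
    UniformIntegrable X 1 P := by
  obtain ⟨-, h2, C, hC⟩ := uniformIntegrable_const (ι := ι) le_rfl ENNReal.one_ne_top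
    (memLp_one_iff_integrable.2 hD)
  have hle (i : ι) (ω : Ω) : ‖X i ω‖ ≤ ‖D ω‖ := (h i ω).trans (le_abs_self _)
  refine ⟨hX, fun ε hε => ?_, C, fun i => (eLpNorm_mono (hle i)).trans (hC i)⟩
  obtain ⟨δ, hδ, h⟩ := h2 hε
  refine ⟨δ, hδ, fun i s hs hsδ => (eLpNorm_mono fun ω => ?_).trans (h i s hs hsδ)⟩
  rw [norm_indicator_eq_indicator_norm, norm_indicator_eq_indicator_norm]
  exact indicator_le_indicator (hle i ω)

section LocalMartingale

variable {Ω : Type*} {mΩ : MeasurableSpace Ω} {P : Measure Ω} [IsFiniteMeasure P]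
  {𝓕 : Filtration ℝ≥0 mΩ} {M : ℝ≥0 → Ω → ℝ}

/-- The martingale identity for the stopped processes passes to the limit by dominated convergence.
-/
lemma isUIMartingale_of_abs_le {N : ℝ≥0 → Ω → ℝ} (had : StronglyAdapted 𝓕 N) (hc : IsCadlag N)
    {T : ℕ → Ω → WithTop ℝ≥0} (hT : ∀ᵐ ω ∂P, Tendsto (T · ω) atTop (𝓝 ⊤))
    (hmart : ∀ n, Martingale (stoppedProcess N (T n)) 𝓕 P) {D : Ω → ℝ} (hD : Integrable D P)
    (h : ∀ t ω, |N t ω| ≤ D ω) : IsUIMartingale N 𝓕 P := by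
  have hm (t : ℝ≥0) : AEStronglyMeasurable (N t) P :=
    ((had t).mono (𝓕.le t)).aestronglyMeasurable
  refine ⟨hc, martingale_of_setIntegral_eq had
    (fun t => hD.mono' (hm t) (ae_of_all _ (h t))) fun s t hst A hA => ?_,
    uniformIntegrable_of_abs_le hm hD h⟩
  have hlim (u : ℝ≥0) : Tendsto (fun n => ∫ ω in A, stoppedProcess N (T n) u ω ∂P) atTop
      (𝓝 (∫ ω in A, N u ω ∂P)) := by
    refine tendsto_integral_of_dominated_convergence D (fun n => ?_) hD.integrableOn
      (fun n => ae_of_all _ fun ω => h _ ω) (ae_restrict_of_ae ?_)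
    · exact ((hmart n).integrable u).aestronglyMeasurable.restrict
    · filter_upwards [hT] with ω hω
      refine tendsto_const_nhds.congr' ?_
      filter_upwards [hω.eventually_const_lt (WithTop.coe_lt_top u)] with n hn
      exact (stoppedProcess_eq_of_le hn.le).symm
  exact tendsto_nhds_unique (hlim t)
    ((hlim s).congr fun n => (hmart n).setIntegral_eq hst hA)

variable [𝓕.IsRightContinuous]

lemma IsLocalMartingale.isUIMartingale_stoppedProcess_firstExitTime (hM : IsLocalMartingale M 𝓕 P)
    {r : ℝ≥0} (hr : ∫⁻ ω, ‖exitValue M r ω‖ₑ ∂P < ∞) :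
    IsUIMartingale (stoppedProcess M (firstExitTime M r)) 𝓕 P := by
  have hτ := isStoppingTime_firstExitTime hM.adapted hM.cadlag r
  have hexit : Integrable (exitValue M r) P :=
    ⟨(measurable_exitValue hM.adapted hM.cadlag r).aestronglyMeasurable, hr⟩
  obtain ⟨T, hT, hmart⟩ := hM.localizes
  refine isUIMartingale_of_abs_le (StronglyAdapted.stoppedProcess_of_isCadlag hM.adapted
    hM.cadlag hτ) (hM.cadlag.stoppedProcess _) hT.tendsto_top (fun n => ?_)
    ((integrable_const (r : ℝ)).add hexit.abs)
    fun t ω => abs_stoppedProcess_firstExitTime_le M r t ω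
  -- The two stoppings commute, so optional stopping applies to the localized martingale.
  rw [stoppedProcess_stoppedProcess, inf_comm, ← stoppedProcess_stoppedProcess]
  exact (hmart n).martingale.stoppedProcess_of_isCadlag (hmart n).cadlag hτ

/-- A local martingale is uniformly integrable if the expected size of its value at the exit time
from `[-r, r]` vanishes along a sequence of levels and its limit inferior is integrable. -/
lemma IsLocalMartingale.isUIMartingale_of_tendsto_exitValue (hM : IsLocalMartingale M 𝓕 P)
    {r : ℕ → ℝ≥0} (hr : ∀ k, 1 ≤ r k)
    (hV : Tendsto (fun k => ∫⁻ ω, ‖exitValue M (r k) ω‖ₑ ∂P) atTop (𝓝 0))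
    (hV' : ∀ k, ∫⁻ ω, ‖exitValue M (r k) ω‖ₑ ∂P < ∞)
    (hlim : ∫⁻ ω, liminf (fun t : ℝ≥0 => ‖M t ω‖ₑ) atTop ∂P < ∞) :
    IsUIMartingale M 𝓕 P := by
  have hmeas (k : ℕ) := measurableSet_firstExitTime_lt_top hM.adapted hM.cadlag (r k)
  have hP : Tendsto (fun k => P {ω | firstExitTime M (r k) ω < ⊤}) atTop (𝓝 0) := by
    refine tendsto_of_tendsto_of_tendsto_of_le_of_le tendsto_const_nhds hV (fun _ => zero_le)
      fun k => ?_
    refine le_trans ?_ (mul_measure_firstExitTime_lt_top_le hM.adapted hM.cadlag (r k))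
    exact le_mul_of_one_le_left' (by exact ENNReal.one_le_coe_iff.2 (hr k))
  have hne : ∀ᵐ ω ∂P, ∃ k, firstExitTime M (r k) ω = ⊤ := by
    refine nonpos_iff_eq_zero.1 (ge_of_tendsto' hP fun k => measure_mono fun ω hω => ?_)
    exact lt_top_iff_ne_top.2 fun h => hω ⟨k, h⟩
  have hstopped (k : ℕ) (t : ℝ≥0) (ω : Ω) (h : firstExitTime M (r k) ω = ⊤) :
      stoppedProcess M (firstExitTime M (r k)) t ω = M t ω :=
    stoppedProcess_apply_of_eq_top h t
  have hUI (k : ℕ) := hM.isUIMartingale_stoppedProcess_firstExitTime (hV' k)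
  choose Zk hZkint hZkcond hZklim using fun k => (hUI k).exists_limit
  have hconv : ∀ᵐ ω ∂P, ∃ l, Tendsto (fun t => M t ω) atTop (𝓝 l) := by
    filter_upwards [hne, ae_all_iff.2 hZklim] with ω ⟨k, hk⟩ h
    exact ⟨Zk k ω, (h k).congr fun t => hstopped k t ω hk⟩
  obtain ⟨Z, hZm, hZ⟩ := measurable_limit_of_tendsto_metrizable_ae
    (fun t => ((hM.adapted t).mono (𝓕.le t)).measurable.aemeasurable) hconv
  have hZint : Integrable Z P := by
    refine ⟨hZm.aestronglyMeasurable, lt_of_le_of_lt (lintegral_mono_ae ?_) hlim⟩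
    filter_upwards [hZ] with ω hω
    exact hω.enorm.liminf_eq.ge
  have hZk : Tendsto (fun k => ∫⁻ ω, ‖Zk k ω - Z ω‖ₑ ∂P) atTop (𝓝 0) := by
    have hle (k : ℕ) : ∫⁻ ω, ‖Zk k ω - Z ω‖ₑ ∂P ≤ ∫⁻ ω, ‖exitValue M (r k) ω‖ₑ ∂P +
        ∫⁻ ω in {ω | firstExitTime M (r k) ω < ⊤}, ‖Z ω‖ₑ ∂P := by
      rw [← lintegral_indicator (hmeas k),
        ← lintegral_add_left (measurable_exitValue hM.adapted hM.cadlag (r k)).enorm]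
      refine lintegral_mono_ae ?_
      filter_upwards [hZ, hZklim k] with ω h1 h2
      rcases h : firstExitTime M (r k) ω with _ | a
      · rw [tendsto_nhds_unique (h2.congr fun t => hstopped k t ω h) h1]
        simp
      · have hmem : ω ∈ {ω | firstExitTime M (r k) ω < ⊤} := by
          rw [mem_ofPred_eq, h]
          exact WithTop.coe_lt_top a
        have h3 : Zk k ω = M a ω := by
          refine tendsto_nhds_unique h2 (tendsto_const_nhds.congr' ?_)
          filter_upwards [eventually_ge_atTop a] with t ht
          rw [stoppedProcess_apply_of_eq_coe h, min_eq_right ht]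
        rw [indicator_of_mem hmem, exitValue_of_eq_coe h, h3]
        exact enorm_sub_le
    refine tendsto_of_tendsto_of_tendsto_of_le_of_le tendsto_const_nhds ?_ (fun _ => zero_le) hle
    simpa using hV.add (tendsto_setLIntegral_zero hZint.2.ne hP)
  have hcond (s : ℝ≥0) : M s =ᵐ[P] P[Z | 𝓕 s] := by
    have hsm (k : ℕ) : AEStronglyMeasurable (stoppedProcess M (firstExitTime M (r k)) s) P :=
      ((hUI k).martingale.integrable s).aestronglyMeasurable
    -- The stopped values at `s` tend in measure to `M s`, being equal to it off the event of exit,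
    -- and in L¹ to the conditional expectation of `Z`.
    refine tendstoInMeasure_ae_unique (u := atTop)
      (f := fun k => stoppedProcess M (firstExitTime M (r k)) s) (fun ε hε => ?_)
      (tendstoInMeasure_of_tendsto_eLpNorm one_ne_zero hsm
        integrable_condExp.aestronglyMeasurable ?_)
    · refine tendsto_of_tendsto_of_tendsto_of_le_of_le tendsto_const_nhds hP (fun _ => zero_le)
        fun k => measure_mono fun ω hω => ?_
      by_contra hmem
      have h : firstExitTime M (r k) ω = ⊤ := not_lt_top_iff.1 hmem
      simp only [mem_ofPred_eq, hstopped k s ω h, edist_self] at hω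
      exact not_le.2 hε hω
    · refine tendsto_of_tendsto_of_tendsto_of_le_of_le tendsto_const_nhds hZk (fun _ => zero_le)
        fun k => ?_
      have : stoppedProcess M (firstExitTime M (r k)) s - P[Z | 𝓕 s] =ᵐ[P]
          P[Zk k - Z | 𝓕 s] :=
        ((hZkcond k s).sub EventuallyEq.rfl).trans (condExp_sub (hZkint k) hZint _).symm
      simp only [eLpNorm_congr_ae this]
      refine (eLpNorm_condExp_le_eLpNorm _ le_rfl).trans_eq ?_
      rw [eLpNorm_one_eq_lintegral_enorm]
      rfl
  exact ⟨hM.cadlag, (martingale_condExp Z 𝓕 P).congr hM.adapted fun t => (hcond t).symm,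
    (hZint.uniformIntegrable_condExp_filtration (f := 𝓕)).ae_eq fun t => (hcond t).symm⟩

end LocalMartingale

/-! ### The equivalence. -/

theorem theorem1 {Ω : Type*} {mΩ : MeasurableSpace Ω} (P : Measure Ω) [IsProbabilityMeasure P]
    (𝓕 : Filtration ℝ≥0 mΩ) [𝓕.IsRightContinuous]
    (M : ℝ≥0 → Ω → ℝ) (hM : IsLocalMartingale M 𝓕 P) :
    IsUIMartingale M 𝓕 P ↔
      liminf (fun r : ℝ≥0 => (r : ℝ≥0∞) * P {ω | (r : ℝ≥0∞) < ⨆ t : ℝ≥0, ‖M t ω‖ₑ}) atTop = 0 ∧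
      Tendsto (fun r : ℝ≥0 => ∫⁻ ω, {ω | firstExitTime M r ω < ⊤}.indicator
        (fun ω => ‖stoppedValue (jump M) (firstExitTime M r) ω‖ₑ) ω ∂P) atTop (𝓝 0) ∧
      ∫⁻ ω, liminf (fun t : ℝ≥0 => ‖M t ω‖ₑ) atTop ∂P < ∞ := by
  simp only [setOf_lt_iSup_enorm_eq]
  constructor
  · intro h
    have hV := h.tendsto_lintegral_exitValue
    refine ⟨(tendsto_of_tendsto_of_tendsto_of_le_of_le tendsto_const_nhds hV (fun _ => zero_le)
      fun r => mul_measure_firstExitTime_lt_top_le hM.adapted hM.cadlag r).liminf_eq,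
      tendsto_of_tendsto_of_tendsto_of_le_of_le tendsto_const_nhds ?_ (fun _ => zero_le)
      fun r => lintegral_jump_le hM.adapted hM.cadlag r, ?_⟩
    · simpa using ENNReal.Tendsto.const_mul (a := 2) hV (Or.inr (by simp))
    · obtain ⟨Z, hZ, -, hlim⟩ := h.exists_limit
      refine lt_of_le_of_lt (lintegral_mono_ae ?_) hZ.2
      filter_upwards [hlim] with ω hω
      exact hω.enorm.liminf_eq.le
  · rintro ⟨hA, hB, hC⟩
    have hM0 : ∫⁻ ω, ‖M 0 ω‖ₑ ∂P ≠ ∞ := by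
      obtain ⟨T, -, hmart⟩ := hM.localizes
      have h0 : stoppedProcess M (T 0) 0 = M 0 :=
        funext fun ω => stoppedProcess_eq_of_le zero_le
      exact (h0 ▸ (hmart 0).martingale.integrable 0).2.ne
    -- (A) holds only frequently in `r`, but (B) holds eventually, so common levels exist. The bound
    -- `1 ≤ r` makes the exit probabilities themselves small.
    have hfreq (k : ℕ) : ∃ r : ℝ≥0, 1 ≤ r ∧
        r * P {ω | firstExitTime M r ω < ⊤} ≤ (k + 1 : ℝ≥0∞)⁻¹ ∧
        ∫⁻ ω, {ω | firstExitTime M r ω < ⊤}.indicator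
          (fun ω => ‖stoppedValue (jump M) (firstExitTime M r) ω‖ₑ) ω ∂P ≤ (k + 1 : ℝ≥0∞)⁻¹ := by
      have hpos : (0 : ℝ≥0∞) < (k + 1 : ℝ≥0∞)⁻¹ := ENNReal.inv_pos.2 (by finiteness)
      have h1 := frequently_lt_of_liminf_lt (by isBoundedDefault) (hA.trans_lt hpos)
      obtain ⟨r, h1, h2, h3⟩ := (h1.and_eventually ((eventually_ge_atTop 1).and
        ((ENNReal.tendsto_nhds_zero.1 hB) _ hpos))).exists
      exact ⟨r, h2, h1.le, h3⟩
    choose r hr1 hrA hrB using hfreq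
    have hinv : Tendsto (fun k : ℕ => (k + 1 : ℝ≥0∞)⁻¹) atTop (𝓝 0) := by
      simpa using (tendsto_add_atTop_iff_nat 1).2 ENNReal.tendsto_inv_nat_nhds_zero
    have hP : Tendsto (fun k => P {ω | firstExitTime M (r k) ω < ⊤}) atTop (𝓝 0) :=
      tendsto_of_tendsto_of_tendsto_of_le_of_le tendsto_const_nhds hinv (fun _ => zero_le)
        fun k => (le_mul_of_one_le_left' (by exact ENNReal.one_le_coe_iff.2 (hr1 k))).trans (hrA k)
    have hle (k : ℕ) : ∫⁻ ω, ‖exitValue M (r k) ω‖ₑ ∂P ≤ (k + 1 : ℝ≥0∞)⁻¹ +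
        ∫⁻ ω in {ω | firstExitTime M (r k) ω < ⊤}, ‖M 0 ω‖ₑ ∂P + (k + 1 : ℝ≥0∞)⁻¹ :=
      (lintegral_exitValue_le hM.adapted hM.cadlag (r k)).trans
        (add_le_add (add_le_add (hrA k) le_rfl) (hrB k))
    refine hM.isUIMartingale_of_tendsto_exitValue hr1 ?_ (fun k => (hle k).trans_lt ?_) hC
    · refine tendsto_of_tendsto_of_tendsto_of_le_of_le tendsto_const_nhds ?_ (fun _ => zero_le) hle
      simpa using (hinv.add (tendsto_setLIntegral_zero hM0 hP)).add hinv
    · have h1 : ∫⁻ ω in {ω | firstExitTime M (r k) ω < ⊤}, ‖M 0 ω‖ₑ ∂P < ∞ :=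
        (setLIntegral_le_lintegral _ _).trans_lt hM0.lt_top
      have h2 : (k + 1 : ℝ≥0∞)⁻¹ < ∞ := ENNReal.inv_lt_top.2 (by positivity)
      exact ENNReal.add_lt_top.2 ⟨ENNReal.add_lt_top.2 ⟨h2, h1⟩, h2⟩
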